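/- Let $r\in\mathbb N$, let $M_r$ be the algebra of complex $r\times r$ matrices with the operator norm, and let $\mathfrak a=((\lambda_j,\alpha_j))_{j\in\mathbb Z}$, where $(\lambda_j)_{j\in\mathbb Z}$ is a strictly increasing sequence of real numbers with $\lambda_0\le 0<\lambda_1$ and the $\alpha_j\in M_r$ are non-zero positive semidefinite matrices. Put $\Delta_n=(\pi n-\frac{\pi}{2},\pi n+\frac{\pi}{2}]$ for $n\in\mathbb Z$, $\mu=\sum_{j\in\mathbb Z}\alpha_j\delta_{\lambda_j}$ and $\mu_0=\sum_{n\in\mathbb Z}I\,\delta_{\pi n}$, and consider the conditions $(A_1)$ $\displaystyle\sup_{n\in\mathbb Z}\sum_{\lambda_j\in\Delta_n}1<\infty,\quad \sum_{n\in\mathbb Z}\sum_{\lambda_j\in\Delta_n}|\lambda_j-\pi n|^2<\infty,\quad \sum_{n\in\mathbb Z}\Big\|I-\sum_{\lambda_j\in\Delta_n}\alpha_j\Big\|^2<\infty$; $(A_3)$ the system $\{d\,e^{i\lambda_j t} : j\in\mathbb Z,\ d\in\operatorname{Ran}\alpha_j\}$ is complete in $L_2((-1,1),\mathbb C^r)$.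 Suppose that $\mathfrak a$ satisfies $(A_1)$. Then the limit $$H_\mu(x)=\lim_{n\to\infty}\int_{(-\pi(n-\frac12),\,\pi(n+\frac12)]}e^{2i\lambda x}\,d(\mu-\mu_0)(\lambda)$$ exists in $L_2((-1,1),M_r)$, and the limit over the symmetric intervals $(-\pi(n+\frac12),\pi(n+\frac12)]$ exists there and is the same function $H_\mu$. If, in addition, $(A_3)$ holds, then $H_\mu$ is an accelerant, that is, for every $a\in[0,1]$ the equation $$f(x)+\int_0^a H_\mu(x-t)f(t)\,dt=0\qquad\text{for a.e. }x\in(0,1)$$ has only the trivial solution $f=0$ in $L_2((0,1),\mathbb C^r)$, and $H_\mu(x)^*=H_\mu(-x)$ for almost every $x\in(-1,1)$. -/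

import Mathlib

open MeasureTheory Filter Topology
open scoped ENNReal ComplexOrder Matrix Matrix.Norms.L2Operator

noncomputable section

namespace KreinDirac

/-- `M_r`: complex `r × r` matrices, normed as operators on the Hermitian space `ℂ^r`. -/
abbrev Mat (r : ℕ) : Type := Matrix (Fin r) (Fin r) ℂ

/-- `ℂ^r` with its Hermitian norm. -/
abbrev Vec (r : ℕ) : Type := EuclideanSpace ℂ (Fin r)

/-- Lebesgue measure on the interval `(a, b)`. -/
abbrev vol (a b : ℝ) : Measure ℝ := volume.restrict (Set.Ioo a b)

/-- A sequence `((λ_j, α_j))_{j ∈ ℤ}`: the `λ_j` are real and strictly increasing with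
`λ_0 ≤ 0 < λ_1`, the `α_j` are nonzero positive semidefinite `r × r` matrices. -/
structure Data (r : ℕ) where
  lam : ℤ → ℝ
  alpha : ℤ → Mat r
  strictMono : StrictMono lam
  lam_zero : lam 0 ≤ 0
  lam_one : 0 < lam 1
  posSemidef : ∀ j, (alpha j).PosSemidef
  ne_zero : ∀ j, alpha j ≠ 0

/-- The interval `Δ_n = (π n - π/2, π n + π/2]`. -/
def Delta (n : ℤ) : Set ℝ :=
  Set.Ioc (Real.pi * n - Real.pi / 2) (Real.pi * n + Real.pi / 2)

/-- The asymptotics `(A₁)`. The first clause makes the inner sums of the other two finite. -/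
structure A1 {r : ℕ} (a : Data r) : Prop where
  bounded_card : ∃ C : ℕ, ∀ n : ℤ, {j : ℤ | a.lam j ∈ Delta n}.encard ≤ C
  summable_lam : Summable fun n : ℤ =>
    ∑ᶠ j ∈ {j : ℤ | a.lam j ∈ Delta n}, |a.lam j - Real.pi * n| ^ 2
  summable_alpha : Summable fun n : ℤ =>
    ‖(1 : Mat r) - ∑ᶠ j ∈ {j : ℤ | a.lam j ∈ Delta n}, a.alpha j‖ ^ 2

/-- The functions `t ↦ e^{i λ_j t} d` with `j ∈ ℤ` and `d ∈ Ran α_j`, as elements of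
`L₂((-1,1), ℂ^r)`. -/
def expSystem {r : ℕ} (a : Data r) : Set (Lp (Vec r) 2 (vol (-1) 1)) :=
  {f | ∃ j : ℤ, ∃ d ∈ Set.range (Matrix.toEuclideanCLM (𝕜 := ℂ) (a.alpha j)),
    f =ᵐ[vol (-1) 1] fun t => Complex.exp (Complex.I * a.lam j * t) • d}

/-- The completeness condition `(A₃)`: the linear span of the exponential system is dense in
`L₂((-1,1), ℂ^r)`. -/
def A3 {r : ℕ} (a : Data r) : Prop :=
  Dense (Submodule.span ℂ (expSystem a) : Set (Lp (Vec r) 2 (vol (-1) 1)))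

/-- The restriction to `S` of the matrix measure `∑_j w_j δ_{p_j}`, for a set `S` that contains only
finitely many of the atoms `p_j`. (The measure on the whole line has infinite mass, so that only
its restrictions to bounded sets are vector measures.) -/
def atomicMeasureOn {r : ℕ} (p : ℤ → ℝ) (w : ℤ → Mat r) (S : Set ℝ) : VectorMeasure ℝ (Mat r) :=
  ∑ᶠ j ∈ {j : ℤ | p j ∈ S}, VectorMeasure.dirac (p j) (w j)

/-- The restriction to `S` of `μ^a = ∑_j α_j δ_{λ_j}`. -/
def muOn {r : ℕ} (a : Data r) (S : Set ℝ) : VectorMeasure ℝ (Mat r) :=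
  atomicMeasureOn a.lam a.alpha S

/-- The restriction to `S` of `μ_0 = ∑_n I δ_{π n}`. -/
def muZeroOn (r : ℕ) (S : Set ℝ) : VectorMeasure ℝ (Mat r) :=
  atomicMeasureOn (fun n : ℤ => Real.pi * n) (fun _ => 1) S

/-- The integral `∫_{(A, B]} e^{2 i λ x} d(μ^a - μ_0)(λ)`. -/
def fourierIntegral {r : ℕ} (a : Data r) (A B x : ℝ) : Mat r :=
  (muOn a (Set.Ioc A B) - muZeroOn r (Set.Ioc A B)).integral
    (fun l : ℝ => Complex.exp (2 * Complex.I * l * x)) (ContinuousLinearMap.lsmul ℝ ℂ)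

/-- `H` is an accelerant: for every `a ∈ [0,1]` the equation
`f(x) + ∫_0^a H(x - t) f(t) dt = 0` has only the trivial solution in `L₂((0,1), ℂ^r)`. -/
def IsAccelerant {r : ℕ} (H : Lp (Mat r) 2 (vol (-1) 1)) : Prop :=
  ∀ a ∈ Set.Icc (0 : ℝ) 1, ∀ f : Lp (Vec r) 2 (vol 0 1),
    (∀ᵐ x ∂(vol 0 1),
      f x + ∫ t in (0 : ℝ)..a, Matrix.toEuclideanCLM (𝕜 := ℂ) (H (x - t)) (f t) = 0) →
    f = 0

/-- The set `𝔥₂` of accelerants. -/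
def accelerants (r : ℕ) : Set (Lp (Mat r) 2 (vol (-1) 1)) := {H | IsAccelerant H}

/-- The set `𝔥₂ˢ` of accelerants with `H(x)^* = H(-x)` for almost every `x ∈ (-1,1)`. -/
def symAccelerants (r : ℕ) : Set (Lp (Mat r) 2 (vol (-1) 1)) :=
  {H | H ∈ accelerants r ∧ ∀ᵐ x ∂(vol (-1) 1), (H x)ᴴ = H (-x)}

end KreinDirac

end

noncomputable section

namespace KreinDirac

/-! ### The intervals `Δ_n` -/

/-! Sort the atoms by cell: `block` n is the sum of e^{2iλ_j x} α_j over λ_j in Δ_n, minus e^{2πinx}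
I. With e^{2πinx} factored out, its k-th Taylor coefficient is bounded by 4^k γ_n, where γ_n =
`blockBound` is square summable by (A₁). For each fixed k Bessel's inequality controls the sum over
n, and the weights x^k/k! with |x| < 1 make the sum over k cost only e^4
(`eLpNorm_sum_expFun_smul_le`). Hence the blocks are unconditionally summable in L₂, so every
exhausting choice of cells, in particular both kinds of window, gives the same H. Each block
satisfies B(x)^* = B(-x), which passes to the limit.

For the accelerant property let g be f cut off to (0, a), let ĝ(l) be the integral of e^{-2ilt} g(t)
over (0,1), and let T_H be convolution with H. The equation gives ‖g‖² + ⟨g, T_H g⟩ = 0. For partial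
sums S_N of the blocks, ⟨g, T_{S_N} g⟩ is the sum of all ⟨ĝ(λ_j), α_j ĝ(λ_j)⟩ minus the sum of
‖ĝ(πn)‖², and by Bessel the latter is at most ‖g‖². In the limit the nonnegative terms must all
vanish, so α_j ĝ(λ_j) = 0 for every j (`matAct_fourierCoeffAt_eq_zero`). After rescaling to (-1,1),
g is orthogonal to the exponential system, so g = 0 by (A₃), and the equation returns f = 0. -/

theorem mem_Delta_iff (x : ℝ) (n : ℤ) : x ∈ Delta n ↔ ⌈x / Real.pi - 1 / 2⌉ = n := by
  have hpi := Real.pi_pos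
  rw [Int.ceil_eq_iff, Delta, Set.mem_Ioc, lt_sub_iff_add_lt, sub_le_iff_le_add,
    lt_div_iff₀ hpi, div_le_iff₀ hpi]
  constructor <;> rintro ⟨h1, h2⟩ <;> constructor <;> linarith

/-- The half-open cells tile the line and the ceiling reads off the cell index, so a window with
ends on cell boundaries is a union of whole cells. -/
theorem mem_Ioc_iff_ceil (x : ℝ) (m M : ℤ) :
    x ∈ Set.Ioc (Real.pi * m - Real.pi / 2) (Real.pi * M + Real.pi / 2) ↔
      ⌈x / Real.pi - 1 / 2⌉ ∈ Finset.Icc m M := by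
  have hpi := Real.pi_pos
  rw [Finset.mem_Icc, Int.ceil_le, ← Int.sub_one_lt_iff, Int.lt_ceil, Set.mem_Ioc,
    lt_sub_iff_add_lt, sub_le_iff_le_add, lt_div_iff₀ hpi, div_le_iff₀ hpi]
  push_cast
  constructor <;> rintro ⟨h1, h2⟩ <;> constructor <;> linarith

theorem abs_sub_le_of_mem_Delta {x : ℝ} {n : ℤ} (h : x ∈ Delta n) :
    |x - Real.pi * n| ≤ Real.pi / 2 := by
  rw [abs_le]
  constructor <;> linarith [h.1, h.2]

/-! ### The integral against an atomic matrix measure is a finite sum -/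

theorem integrable_exp_atomicMeasureOn {r : ℕ} (p : ℤ → ℝ) (w : ℤ → Mat r) (S : Set ℝ)
    (hS : {j : ℤ | p j ∈ S}.Finite) (x : ℝ) :
    (atomicMeasureOn p w S).Integrable (fun l : ℝ => Complex.exp (2 * Complex.I * l * x)) := by
  rw [atomicMeasureOn, finsum_mem_eq_finite_toFinset_sum _ hS]
  refine VectorMeasure.Integrable.finsetSum_vectorMeasure fun j _ => ?_
  refine Integrable.of_bound (C := 1) (by fun_prop) (ae_of_all _ fun l => ?_)
  rw [Complex.norm_exp]
  simp

theorem integral_exp_atomicMeasureOn {r : ℕ} (p : ℤ → ℝ) (w : ℤ → Mat r) (S : Set ℝ)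
    (hS : {j : ℤ | p j ∈ S}.Finite) (x : ℝ) :
    (atomicMeasureOn p w S).integral (fun l : ℝ => Complex.exp (2 * Complex.I * l * x))
        (ContinuousLinearMap.lsmul ℝ ℂ) =
      ∑ j ∈ hS.toFinset, Complex.exp (2 * Complex.I * p j * x) • w j := by
  rw [atomicMeasureOn, finsum_mem_eq_finite_toFinset_sum _ hS,
    VectorMeasure.integral_finsetSum_vectorMeasure]
  · simp [VectorMeasure.integral_dirac]
  · intro j _
    refine Integrable.of_bound (C := 1) (by fun_prop) (ae_of_all _ fun l => ?_)
    rw [Complex.norm_exp]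
    simp

/-- The contribution of `Δ_n` to the Fourier integral of `μ^a - μ_0`, where the finset `J n`
consists of the indices of the `λ_j` in `Δ_n`. -/
def block {r : ℕ} (a : Data r) (J : ℤ → Finset ℤ) (n : ℤ) (x : ℝ) : Mat r :=
  ∑ j ∈ J n, Complex.exp (2 * Complex.I * a.lam j * x) • a.alpha j -
    Complex.exp (2 * Complex.I * (Real.pi * n : ℝ) * x) • (1 : Mat r)

theorem fourierIntegral_eq_sum_block {r : ℕ} (a : Data r) (J : ℤ → Finset ℤ)
    (hJ : ∀ n j, j ∈ J n ↔ a.lam j ∈ Delta n) (m M : ℤ) (x : ℝ) :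
    fourierIntegral a (Real.pi * m - Real.pi / 2) (Real.pi * M + Real.pi / 2) x =
      ∑ n ∈ Finset.Icc m M, block a J n x := by
  classical
  set S := Set.Ioc (Real.pi * m - Real.pi / 2) (Real.pi * M + Real.pi / 2) with hSdef
  have h1 : {j : ℤ | a.lam j ∈ S} = ((Finset.Icc m M).biUnion J : Finset ℤ) := by
    ext j
    simp only [Set.mem_ofPred_eq, hSdef, mem_Ioc_iff_ceil, Finset.coe_biUnion, Set.mem_iUnion,
      Finset.mem_coe, hJ, mem_Delta_iff]
    simp
  have h2 : {n : ℤ | Real.pi * n ∈ S} = (Finset.Icc m M : Finset ℤ) := by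
    ext n
    have : Real.pi * n ∈ Delta n := by
      constructor <;> linarith [Real.pi_pos]
    rw [mem_Delta_iff] at this
    simp only [Set.mem_ofPred_eq, hSdef, mem_Ioc_iff_ceil, this, Finset.mem_coe]
  have f1 : {j : ℤ | a.lam j ∈ S}.Finite := h1 ▸ Finset.finite_toSet _
  have f2 : {n : ℤ | Real.pi * n ∈ S}.Finite := h2 ▸ Finset.finite_toSet _
  have e1 : f1.toFinset = (Finset.Icc m M).biUnion J := by
    apply Finset.coe_injective; rw [Set.Finite.coe_toFinset, h1]
  have e2 : f2.toFinset = Finset.Icc m M := by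
    apply Finset.coe_injective; rw [Set.Finite.coe_toFinset, h2]
  rw [fourierIntegral, muOn, muZeroOn, VectorMeasure.integral_sub_vectorMeasure
    (integrable_exp_atomicMeasureOn _ _ _ f1 x) (integrable_exp_atomicMeasureOn _ _ _ f2 x),
    integral_exp_atomicMeasureOn _ _ _ f1, integral_exp_atomicMeasureOn _ _ _ f2, e1, e2,
    Finset.sum_biUnion]
  · simp only [block, Finset.sum_sub_distrib]
  · intro n _ n' _ hn
    refine Finset.disjoint_left.2 fun j h h' => hn ?_
    rw [hJ, mem_Delta_iff] at h h'
    exact h.symm.trans h'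

theorem block_conjTranspose {r : ℕ} (a : Data r) (J : ℤ → Finset ℤ) (n : ℤ) (x : ℝ) :
    (block a J n x)ᴴ = block a J n (-x) := by
  have h (l : ℝ) : star (Complex.exp (2 * Complex.I * l * x)) =
      Complex.exp (2 * Complex.I * l * ((-x : ℝ) : ℂ)) := by
    rw [Complex.star_def, ← Complex.exp_conj]
    simp [map_ofNat (starRingEnd ℂ) 2]
  simp only [block, Matrix.conjTranspose_sub, Matrix.conjTranspose_sum, Matrix.conjTranspose_smul,
    h, (a.posSemidef _).isHermitian.eq, Matrix.conjTranspose_one]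

/-! ### Exponentials -/

/-- The function `x ↦ e^{2 i l x}`. -/
def expFun (l x : ℝ) : ℂ := Complex.exp (2 * Complex.I * l * x)

theorem continuous_expFun (l : ℝ) : Continuous (expFun l) := by
  unfold expFun; fun_prop

theorem norm_expFun (l x : ℝ) : ‖expFun l x‖ = 1 := by
  rw [expFun, Complex.norm_exp]; simp

theorem expFun_add (l m x : ℝ) : expFun (l + m) x = expFun l x * expFun m x := by
  rw [expFun, expFun, expFun, ← Complex.exp_add]; push_cast; ring_nf

theorem conj_expFun (l x : ℝ) : (starRingEnd ℂ) (expFun l x) = expFun (-l) x := by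
  rw [expFun, expFun, ← Complex.exp_conj]
  simp [map_ofNat (starRingEnd ℂ) 2]

/-- The product has period 1, so orthogonality holds on every interval of integer length. Length 2
serves H on (-1,1), length 1 serves g on (0,1). -/
theorem integral_expFun_mul (A : ℝ) (k : ℕ) (n m : ℤ) :
    ∫ x, expFun (Real.pi * m) x * (starRingEnd ℂ) (expFun (Real.pi * n) x) ∂vol A (A + k) =
      if n = m then (k : ℂ) else 0 := by
  have hk : A ≤ A + k := by simp
  have h1 (x : ℝ) : expFun (Real.pi * m) x * (starRingEnd ℂ) (expFun (Real.pi * n) x) =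
      Complex.exp ((2 * Real.pi * Complex.I * (m - n)) * x) := by
    rw [conj_expFun, ← expFun_add, expFun]
    push_cast
    ring_nf
  simp only [h1]
  rw [← integral_Ioc_eq_integral_Ioo, ← intervalIntegral.integral_of_le hk]
  split_ifs with hnm
  · simp [hnm]
  · have hc : (2 * Real.pi * Complex.I * (m - n) : ℂ) ≠ 0 := by
      have : (m - n : ℂ) ≠ 0 := by
        rw [sub_ne_zero]; exact_mod_cast Ne.symm hnm
      simpa [Real.pi_ne_zero] using this
    rw [integral_exp_mul_complex hc]
    have h2 : Complex.exp ((2 * Real.pi * Complex.I * (m - n)) * ((A + k : ℝ) : ℂ)) =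
        Complex.exp ((2 * Real.pi * Complex.I * (m - n)) * A) := by
      rw [Complex.exp_eq_exp_iff_exists_int]
      refine ⟨(m - n) * k, ?_⟩
      push_cast
      ring
    rw [h2, sub_self, zero_div]

theorem memLp_expFun_smul {V : Type*} [NormedAddCommGroup V] [NormedSpace ℂ V] (A B l : ℝ) (v : V) :
    MemLp (fun x => expFun l x • v) 2 (vol A B) := by
  refine MemLp.of_bound (C := ‖v‖) ?_ (ae_of_all _ fun x => ?_)
  · exact ((continuous_expFun l).smul continuous_const).aestronglyMeasurable
  · rw [norm_smul, norm_expFun, one_mul]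

theorem eLpNorm_sum_expFun_mul (A : ℝ) (k : ℕ) (F : Finset ℤ) (c : ℤ → ℂ) :
    eLpNorm (fun x => ∑ n ∈ F, expFun (Real.pi * n) x * c n) 2 (vol A (A + k)) =
      ENNReal.ofReal (√(k * ∑ n ∈ F, ‖c n‖ ^ 2)) := by
  let e (n : ℤ) : Lp ℂ 2 (vol A (A + k)) := (memLp_expFun_smul A (A + k) (Real.pi * n) (1 : ℂ)).toLp
  have he (n m : ℤ) : inner ℂ (e n) (e m) = if n = m then (k : ℂ) else 0 := by
    rw [← integral_expFun_mul A k n m, L2.inner_def]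
    refine integral_congr_ae ?_
    filter_upwards [(memLp_expFun_smul A (A + k) (Real.pi * n) (1 : ℂ)).coeFn_toLp,
      (memLp_expFun_smul A (A + k) (Real.pi * m) (1 : ℂ)).coeFn_toLp] with x h1 h2
    simp only [e]
    rw [h1, h2]
    simp
  have hsum : ‖∑ n ∈ F, c n • e n‖ ^ 2 = k * ∑ n ∈ F, ‖c n‖ ^ 2 := by
    have : ((‖∑ n ∈ F, c n • e n‖ ^ 2 : ℝ) : ℂ) = ((k * ∑ n ∈ F, ‖c n‖ ^ 2 : ℝ) : ℂ) := by
      push_cast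
      refine (inner_self_eq_norm_sq_to_K (𝕜 := ℂ) (∑ n ∈ F, c n • e n)).symm.trans ?_
      rw [sum_inner, Finset.mul_sum]
      refine Finset.sum_congr rfl fun n hn => ?_
      simp [inner_sum, inner_smul_left, inner_smul_right, he, hn, ← Complex.mul_conj']
      ring
    exact_mod_cast this
  have hae : (∑ n ∈ F, c n • e n : Lp ℂ 2 (vol A (A + k))) =ᵐ[vol A (A + k)]
      fun x => ∑ n ∈ F, expFun (Real.pi * n) x * c n := by
    have h1 (n : ℤ) : (c n • e n : Lp ℂ 2 (vol A (A + k))) =ᵐ[vol A (A + k)]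
        fun x => expFun (Real.pi * n) x * c n := by
      filter_upwards [(memLp_expFun_smul A (A + k) (Real.pi * n) (1 : ℂ)).coeFn_toLp,
        Lp.coeFn_smul (c n) (e n)] with x h1 h2
      rw [h2, Pi.smul_apply, h1, smul_eq_mul, smul_eq_mul, mul_one, mul_comm]
    filter_upwards [Lp.coeFn_finsetSum F (fun n => c n • e n), ae_all_iff.2 h1] with x h2 h3
    rw [h2, Finset.sum_apply]
    exact Finset.sum_congr rfl fun n _ => h3 n
  rw [← eLpNorm_congr_ae hae, ← hsum, Real.sqrt_sq (norm_nonneg _), Lp.norm_def,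
    ENNReal.ofReal_toReal (Lp.eLpNorm_ne_top _)]

/-- The operator norm on matrices is in general not a Hilbert norm, so Parseval is applied to each
coordinate in a basis; the constant depends on the basis. -/
theorem exists_eLpNorm_sum_expFun_smul_le (V : Type*) [NormedAddCommGroup V] [NormedSpace ℂ V]
    [FiniteDimensional ℂ V] :
    ∃ K : ℝ, 0 ≤ K ∧ ∀ (F : Finset ℤ) (c : ℤ → V),
      eLpNorm (fun x => ∑ n ∈ F, expFun (Real.pi * n) x • c n) 2 (vol (-1) 1) ≤
        ENNReal.ofReal (K * √(∑ n ∈ F, ‖c n‖ ^ 2)) := by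
  let b := Module.finBasis ℂ V
  let φ (i) : V →L[ℂ] ℂ := LinearMap.toContinuousLinearMap (b.coord i)
  refine ⟨∑ i, √2 * ‖φ i‖ * ‖b i‖, by positivity, fun F c => ?_⟩
  have h1 (x : ℝ) : ∑ n ∈ F, expFun (Real.pi * n) x • c n =
      ∑ i, (∑ n ∈ F, expFun (Real.pi * n) x * φ i (c n)) • b i := by
    simp only [Finset.sum_smul]
    rw [Finset.sum_comm]
    refine Finset.sum_congr rfl fun n _ => ?_
    conv_lhs => rw [← b.sum_repr (c n), Finset.smul_sum]
    simp [φ, mul_smul]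
  have h2 (i) : eLpNorm (fun x => (∑ n ∈ F, expFun (Real.pi * n) x * φ i (c n)) • b i) 2
      (vol (-1) 1) ≤ ENNReal.ofReal (√2 * ‖φ i‖ * ‖b i‖ * √(∑ n ∈ F, ‖c n‖ ^ 2)) := by
    have h3 := eLpNorm_le_mul_eLpNorm_of_ae_le_mul (p := 2) (μ := vol (-1) 1) (c := ‖b i‖)
      (f := fun x => (∑ n ∈ F, expFun (Real.pi * n) x * φ i (c n)) • b i)
      (g := fun x => ∑ n ∈ F, expFun (Real.pi * n) x * φ i (c n))
      (ae_of_all _ fun x => by rw [norm_smul, mul_comm])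
    have h4 := eLpNorm_sum_expFun_mul (-1) 2 F (fun n => φ i (c n))
    norm_num at h4
    refine h3.trans ?_
    rw [h4, ← ENNReal.ofReal_mul (by positivity), ← ENNReal.ofReal_mul (norm_nonneg _)]
    refine ENNReal.ofReal_le_ofReal ?_
    have h5 : √(∑ n ∈ F, ‖φ i (c n)‖ ^ 2) ≤ ‖φ i‖ * √(∑ n ∈ F, ‖c n‖ ^ 2) := by
      rw [Real.sqrt_le_left (by positivity), mul_pow, Real.sq_sqrt (by positivity),
        Finset.mul_sum]
      refine Finset.sum_le_sum fun n _ => ?_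
      rw [← mul_pow]
      gcongr
      exact (φ i).le_opNorm _
    calc _ ≤ ‖b i‖ * (√2 * (‖φ i‖ * √(∑ n ∈ F, ‖c n‖ ^ 2))) := by gcongr
      _ = _ := by ring
  simp only [h1]
  rw [Finset.sum_mul, ENNReal.ofReal_sum_of_nonneg (fun i _ => by positivity)]
  refine (le_of_eq ?_).trans ((eLpNorm_sum_le (f := fun i x =>
    (∑ n ∈ F, expFun (Real.pi * n) x * φ i (c n)) • b i) (fun i _ => ?_) (by norm_num)).trans
    (Finset.sum_le_sum fun i _ => h2 i))
  · congr 1; ext x; simp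
  · refine Continuous.aestronglyMeasurable ?_
    have := continuous_expFun
    fun_prop

/-- A perturbed form of Bessel's inequality: the Fourier coefficients may depend on the variable,
as long as they are entire functions of it with Taylor coefficients under control. -/
theorem eLpNorm_sum_expFun_smul_le {V : Type*} [NormedAddCommGroup V] [NormedSpace ℂ V]
    {K : ℝ} (hK0 : 0 ≤ K) (hK : ∀ (F : Finset ℤ) (c : ℤ → V),
      eLpNorm (fun x => ∑ n ∈ F, expFun (Real.pi * n) x • c n) 2 (vol (-1) 1) ≤
        ENNReal.ofReal (K * √(∑ n ∈ F, ‖c n‖ ^ 2)))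
    (R : ℝ) (hR : 0 ≤ R) (d : ℤ → ℕ → V) (γ : ℤ → ℝ)
    (hd : ∀ n k, ‖d n k‖ ≤ R ^ k * γ n) (G : ℤ → ℝ → V)
    (hG : ∀ n (x : ℝ), HasSum (fun k : ℕ => ((x : ℂ) ^ k / k.factorial) • d n k) (G n x))
    (F : Finset ℤ) :
    eLpNorm (fun x => ∑ n ∈ F, expFun (Real.pi * n) x • G n x) 2 (vol (-1) 1) ≤
      ENNReal.ofReal (Real.exp R * K * √(∑ n ∈ F, γ n ^ 2)) := by
  -- Interchange of sums: `T k` gathers the k-th Taylor terms of all n, so that its coefficients no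
  -- longer depend on x and Bessel applies.
  let T (k : ℕ) (x : ℝ) : V :=
    ((x : ℂ) ^ k / k.factorial) • ∑ n ∈ F, expFun (Real.pi * n) x • d n k
  have hTc (k : ℕ) : AEStronglyMeasurable (T k) (vol (-1) 1) := by
    refine Continuous.aestronglyMeasurable ?_
    have := continuous_expFun
    fun_prop
  have hT (k : ℕ) : eLpNorm (T k) 2 (vol (-1) 1) ≤
      ENNReal.ofReal (R ^ k / k.factorial * (K * √(∑ n ∈ F, γ n ^ 2))) := by
    have h3 := eLpNorm_le_mul_eLpNorm_of_ae_le_mul (p := 2) (μ := vol (-1) 1)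
      (c := (k.factorial : ℝ)⁻¹) (f := T k) (g := fun x => ∑ n ∈ F, expFun (Real.pi * n) x • d n k)
      (by
        filter_upwards [ae_restrict_mem measurableSet_Ioo] with x hx
        simp only [T]
        rw [norm_smul]
        gcongr
        rw [norm_div, norm_pow, Complex.norm_natCast, Complex.norm_real, ← one_div]
        gcongr
        exact pow_le_one₀ (norm_nonneg _) (abs_le.2 ⟨hx.1.le, hx.2.le⟩))
    refine (h3.trans (mul_le_mul_right (hK F _) _)).trans ?_
    rw [← ENNReal.ofReal_mul (by positivity)]
    refine ENNReal.ofReal_le_ofReal ?_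
    have h5 : √(∑ n ∈ F, ‖d n k‖ ^ 2) ≤ R ^ k * √(∑ n ∈ F, γ n ^ 2) := by
      rw [Real.sqrt_le_left (by positivity), mul_pow, Real.sq_sqrt (by positivity),
        Finset.mul_sum]
      refine Finset.sum_le_sum fun n _ => ?_
      rw [← mul_pow]
      gcongr
      exact hd n k
    calc _ ≤ (k.factorial : ℝ)⁻¹ * (K * (R ^ k * √(∑ n ∈ F, γ n ^ 2))) := by gcongr
      _ = _ := by ring
  have hlim (x : ℝ) : Tendsto (fun N : ℕ => (∑ k ∈ Finset.range N, T k) x) atTop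
      (𝓝 (∑ n ∈ F, expFun (Real.pi * n) x • G n x)) := by
    have h1 : HasSum (fun k => T k x) (∑ n ∈ F, expFun (Real.pi * n) x • G n x) := by
      refine (hasSum_sum fun n _ => (hG n x).const_smul (expFun (Real.pi * n) x)).congr_fun ?_
      intro k
      simp only [T, Finset.smul_sum]
      exact Finset.sum_congr rfl fun n _ => smul_comm _ _ _
    simpa using h1.tendsto_sum_nat
  -- Fatou: pointwise convergence of the partial sums in k and a uniform bound on their norms
  -- suffice.
  refine (Lp.eLpNorm_lim_le_liminf_eLpNorm
    (fun N => Finset.aestronglyMeasurable_sum _ fun k _ => hTc k) _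
    (ae_of_all _ hlim)).trans ?_
  refine liminf_le_of_le (by isBoundedDefault) fun b hb => ?_
  obtain ⟨N, hN⟩ := hb.exists
  refine hN.trans ((eLpNorm_sum_le (fun k _ => hTc k) (by norm_num)).trans
    ((Finset.sum_le_sum fun k _ => hT k).trans ?_))
  rw [← ENNReal.ofReal_sum_of_nonneg (fun k _ => by positivity), ← Finset.sum_mul, mul_assoc]
  refine ENNReal.ofReal_le_ofReal ?_
  gcongr
  exact Real.sum_le_exp_of_nonneg hR N

/-! ### Convergence of the Fourier integrals -/

open scoped MatrixOrder in
-- (A₁) controls only the sums of the α_j over a cell; monotonicity of the norm on positive matrices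
-- passes the bound to each α_j.
theorem norm_le_norm_sum_of_posSemidef {r : ℕ} {ι : Type*} (s : Finset ι) (α : ι → Mat r)
    (hα : ∀ i, (α i).PosSemidef) {i : ι} (hi : i ∈ s) : ‖α i‖ ≤ ‖∑ j ∈ s, α j‖ :=
  CStarAlgebra.norm_le_norm_of_nonneg_of_le (hα i).nonneg
    (Finset.single_le_sum (fun j _ => (hα j).nonneg) hi)

theorem continuous_block {r : ℕ} (a : Data r) (J : ℤ → Finset ℤ) (n : ℤ) :
    Continuous (block a J n) := by
  unfold block
  fun_prop

theorem memLp_block {r : ℕ} (a : Data r) (J : ℤ → Finset ℤ) (n : ℤ) :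
    MemLp (block a J n) 2 (vol (-1) 1) := by
  have h := (memLp_finsetSum (J n) fun j _ =>
    memLp_expFun_smul (-1) 1 (a.lam j) (a.alpha j)).sub
      (memLp_expFun_smul (-1) 1 (Real.pi * n) (1 : Mat r))
  exact h

/-- The size of the Taylor coefficients of the block with index `n`. -/
def blockBound {r : ℕ} (a : Data r) (J : ℤ → Finset ℤ) (n : ℤ) : ℝ :=
  ‖(1 : Mat r) - ∑ j ∈ J n, a.alpha j‖ + ∑ j ∈ J n, |a.lam j - Real.pi * n| * ‖a.alpha j‖

theorem summable_blockBound_sq {r : ℕ} (a : Data r) (J : ℤ → Finset ℤ) {C : ℕ}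
    (hC : ∀ n, (J n).card ≤ C)
    (hlam : Summable fun n : ℤ => ∑ j ∈ J n, |a.lam j - Real.pi * n| ^ 2)
    (halpha : Summable fun n : ℤ => ‖(1 : Mat r) - ∑ j ∈ J n, a.alpha j‖ ^ 2) :
    Summable fun n => blockBound a J n ^ 2 := by
  -- A term of a nonnegative series is at most its total, so each cell sum of the α_j has norm at
  -- most `B`.
  set T := ∑' n : ℤ, ‖(1 : Mat r) - ∑ j ∈ J n, a.alpha j‖ ^ 2
  set B := ‖(1 : Mat r)‖ + √T
  have hB0 : 0 ≤ B := by positivity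
  have h1 (n : ℤ) : ‖(1 : Mat r) - ∑ j ∈ J n, a.alpha j‖ ≤ √T :=
    Real.le_sqrt_of_sq_le (halpha.le_tsum n fun _ _ => by positivity)
  have h2 (n : ℤ) (j : ℤ) (hj : j ∈ J n) : ‖a.alpha j‖ ≤ B := by
    refine (norm_le_norm_sum_of_posSemidef _ _ a.posSemidef hj).trans ?_
    have := norm_sub_le (1 : Mat r) (1 - ∑ j ∈ J n, a.alpha j)
    rw [sub_sub_cancel] at this
    linarith [h1 n]
  refine Summable.of_nonneg_of_le (fun n => sq_nonneg _) (fun n => ?_)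
    ((halpha.mul_left 2).add (hlam.mul_left (2 * (B ^ 2 * C))))
  have h3 : ∑ j ∈ J n, |a.lam j - Real.pi * n| * ‖a.alpha j‖ ≤
      B * ∑ j ∈ J n, |a.lam j - Real.pi * n| := by
    rw [Finset.mul_sum]
    refine Finset.sum_le_sum fun j hj => ?_
    rw [mul_comm]
    gcongr
    exact h2 n j hj
  have h4 : (∑ j ∈ J n, |a.lam j - Real.pi * n|) ^ 2 ≤
      C * ∑ j ∈ J n, |a.lam j - Real.pi * n| ^ 2 := by
    refine sq_sum_le_card_mul_sum_sq.trans ?_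
    gcongr
    exact_mod_cast hC n
  calc blockBound a J n ^ 2
      ≤ 2 * (‖(1 : Mat r) - ∑ j ∈ J n, a.alpha j‖ ^ 2 +
        (∑ j ∈ J n, |a.lam j - Real.pi * n| * ‖a.alpha j‖) ^ 2) := add_sq_le
    _ ≤ 2 * (‖(1 : Mat r) - ∑ j ∈ J n, a.alpha j‖ ^ 2 +
        (B * ∑ j ∈ J n, |a.lam j - Real.pi * n|) ^ 2) := by gcongr
    _ ≤ 2 * (‖(1 : Mat r) - ∑ j ∈ J n, a.alpha j‖ ^ 2 +
        B ^ 2 * (C * ∑ j ∈ J n, |a.lam j - Real.pi * n| ^ 2)) := by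
        rw [mul_pow]; gcongr
    _ = _ := by ring

/-- The Taylor coefficients of `e^{-2 π i n x}` times the block with index `n`. -/
def blockCoeff {r : ℕ} (a : Data r) (J : ℤ → Finset ℤ) (n : ℤ) (k : ℕ) : Mat r :=
  ∑ j ∈ J n, (2 * Complex.I * (a.lam j - Real.pi * n : ℝ)) ^ k • a.alpha j -
    (if k = 0 then 1 else 0)

/-- With δ = λ_j - πn, |2δ| ≤ π ≤ 4. For positive powers one factor |δ| is kept, since square
summability in n comes from it. -/
theorem norm_blockCoeff_le {r : ℕ} (a : Data r) (J : ℤ → Finset ℤ)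
    (hJ : ∀ n j, j ∈ J n ↔ a.lam j ∈ Delta n) (n : ℤ) (k : ℕ) :
    ‖blockCoeff a J n k‖ ≤ 4 ^ k * blockBound a J n := by
  rcases k with _ | k
  · simp only [blockCoeff, blockBound, pow_zero, one_smul, if_true, one_mul]
    rw [norm_sub_rev]
    exact le_add_of_nonneg_right (by positivity)
  · simp only [blockCoeff, blockBound, Nat.succ_ne_zero, if_false, sub_zero, mul_add,
      Finset.mul_sum]
    refine (norm_sum_le _ _).trans (le_add_of_nonneg_of_le (by positivity)
      (Finset.sum_le_sum fun j hj => ?_))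
    have hδ := abs_sub_le_of_mem_Delta ((hJ n j).1 hj)
    set δ := a.lam j - Real.pi * n
    have hδ2 : |δ| ≤ 2 := by linarith [Real.pi_le_four]
    rw [norm_smul, norm_pow, ← mul_assoc]
    gcongr
    rw [norm_mul, norm_mul, Complex.norm_real, Complex.norm_I, Complex.norm_ofNat, mul_one,
      Real.norm_eq_abs, pow_succ]
    calc (2 * |δ|) ^ k * (2 * |δ|) ≤ (2 * 2) ^ k * (4 * |δ|) := by
          gcongr; norm_num
      _ = 4 ^ (k + 1) * |δ| := by ring

theorem expFun_smul_eq_block {r : ℕ} (a : Data r) (J : ℤ → Finset ℤ) (n : ℤ) (x : ℝ) :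
    expFun (Real.pi * n) x • (∑ j ∈ J n, expFun (a.lam j - Real.pi * n) x • a.alpha j - 1) =
      block a J n x := by
  rw [smul_sub, Finset.smul_sum, block]
  congr 1
  refine Finset.sum_congr rfl fun j _ => ?_
  rw [smul_smul, ← expFun_add, add_sub_cancel, expFun]

theorem hasSum_blockCoeff {r : ℕ} (a : Data r) (J : ℤ → Finset ℤ) (n : ℤ) (x : ℝ) :
    HasSum (fun k : ℕ => ((x : ℂ) ^ k / k.factorial) • blockCoeff a J n k)
      (∑ j ∈ J n, expFun (a.lam j - Real.pi * n) x • a.alpha j - 1) := by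
  have h1 (j : ℤ) : HasSum (fun k : ℕ => ((x : ℂ) ^ k / k.factorial) •
      (2 * Complex.I * (a.lam j - Real.pi * n : ℝ)) ^ k • a.alpha j)
      (expFun (a.lam j - Real.pi * n) x • a.alpha j) := by
    have h := NormedSpace.expSeries_div_hasSum_exp (𝔸 := ℂ)
      (2 * Complex.I * (a.lam j - Real.pi * n : ℝ) * x)
    rw [← Complex.exp_eq_exp_ℂ] at h
    refine (h.smul_const (a.alpha j)).congr_fun fun k => ?_
    rw [smul_smul, mul_pow]
    congr 1
    ring
  have h2 : HasSum (fun k : ℕ => ((x : ℂ) ^ k / k.factorial) •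
      (if k = 0 then 1 else 0 : Mat r)) 1 := by
    refine (hasSum_ite_eq 0 (1 : Mat r)).congr_fun fun k => ?_
    split_ifs with h <;> simp [h]
  refine ((hasSum_sum fun j _ => h1 j).sub h2).congr_fun fun k => ?_
  rw [blockCoeff, smul_sub, Finset.smul_sum]

theorem exists_eLpNorm_sum_block_le {r : ℕ} (a : Data r) (J : ℤ → Finset ℤ)
    (hJ : ∀ n j, j ∈ J n ↔ a.lam j ∈ Delta n) :
    ∃ K : ℝ, 0 ≤ K ∧ ∀ F : Finset ℤ,
      eLpNorm (fun x => ∑ n ∈ F, block a J n x) 2 (vol (-1) 1) ≤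
        ENNReal.ofReal (K * √(∑ n ∈ F, blockBound a J n ^ 2)) := by
  obtain ⟨K, hK0, hK⟩ := exists_eLpNorm_sum_expFun_smul_le (Mat r)
  refine ⟨Real.exp 4 * K, by positivity, fun F => ?_⟩
  have h := eLpNorm_sum_expFun_smul_le hK0 hK 4 (by norm_num) (blockCoeff a J) (blockBound a J)
    (norm_blockCoeff_le a J hJ) _ (hasSum_blockCoeff a J) F
  simpa only [expFun_smul_eq_block] using h

theorem summable_of_norm_sum_le_sqrt {E : Type*} [NormedAddCommGroup E] [CompleteSpace E]
    {ι : Type*} {f : ι → E} {g : ι → ℝ} (hg : Summable g) {K : ℝ} (hK : 0 ≤ K)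
    (h : ∀ F : Finset ι, ‖∑ i ∈ F, f i‖ ≤ K * √(∑ i ∈ F, g i)) : Summable f := by
  rw [summable_iff_vanishing_norm] at hg ⊢
  intro ε hε
  -- `K + 1` in place of `K` covers K = 0.
  obtain ⟨s, hs⟩ := hg ((ε / (K + 1)) ^ 2) (by positivity)
  refine ⟨s, fun t ht => (h t).trans_lt ?_⟩
  have h1 : √(∑ i ∈ t, g i) < ε / (K + 1) := by
    rw [Real.sqrt_lt' (by positivity)]
    exact (le_abs_self _).trans_lt (hs t ht)
  rw [lt_div_iff₀ (by positivity)] at h1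
  nlinarith [Real.sqrt_nonneg (∑ i ∈ t, g i)]

theorem summable_block {r : ℕ} (a : Data r) (J : ℤ → Finset ℤ)
    (hJ : ∀ n j, j ∈ J n ↔ a.lam j ∈ Delta n)
    (hbound : Summable fun n => blockBound a J n ^ 2) :
    Summable fun n => (memLp_block a J n).toLp := by
  obtain ⟨K, hK0, hK⟩ := exists_eLpNorm_sum_block_le a J hJ
  refine summable_of_norm_sum_le_sqrt hbound hK0 fun F => ?_
  rw [Lp.norm_def]
  refine ENNReal.toReal_le_of_le_ofReal (by positivity) ((le_of_eq ?_).trans (hK F))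
  refine eLpNorm_congr_ae ?_
  filter_upwards [Lp.coeFn_finsetSum F (fun n => (memLp_block a J n).toLp),
    ae_all_iff.2 fun n => (memLp_block a J n).coeFn_toLp] with x h1 h2
  rw [h1, Finset.sum_apply]
  exact Finset.sum_congr rfl fun n _ => h2 n

theorem tendsto_eLpNorm_sum_block_sub {r : ℕ} (a : Data r) (J : ℤ → Finset ℤ)
    {H : Lp (Mat r) 2 (vol (-1) 1)} (hH : HasSum (fun n => (memLp_block a J n).toLp) H)
    {F : ℕ → Finset ℤ} (hF : Tendsto F atTop atTop) :
    Tendsto (fun N : ℕ => eLpNorm (fun x => ∑ n ∈ F N, block a J n x - H x) 2 (vol (-1) 1))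
      atTop (𝓝 0) := by
  have h1 := (Lp.tendsto_Lp_iff_tendsto_eLpNorm' _ _).1 (hH.comp hF)
  refine h1.congr fun N => eLpNorm_congr_ae ?_
  filter_upwards [Lp.coeFn_finsetSum (F N) (fun n => (memLp_block a J n).toLp),
    ae_all_iff.2 fun n => (memLp_block a J n).coeFn_toLp] with x h1 h2
  simp only [Function.comp_apply, Pi.sub_apply]
  rw [h1, Finset.sum_apply]
  congr 1
  exact Finset.sum_congr rfl fun n _ => h2 n

/-! ### Symmetry of the limit -/

theorem measurePreserving_neg_vol :
    MeasurePreserving (fun x : ℝ => -x) (vol (-1) 1) (vol (-1) 1) := by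
  have h := (Measure.measurePreserving_neg (volume : Measure ℝ)).restrict_preimage
    (measurableSet_Ioo (a := (-1 : ℝ)) (b := 1))
  simpa [vol] using h

theorem eLpNorm_comp_neg {V : Type*} [NormedAddCommGroup V] {f : ℝ → V}
    (hf : AEStronglyMeasurable f (vol (-1) 1)) :
    eLpNorm (fun x => f (-x)) 2 (vol (-1) 1) = eLpNorm f 2 (vol (-1) 1) :=
  eLpNorm_comp_measurePreserving hf measurePreserving_neg_vol

theorem aestronglyMeasurable_comp_neg {V : Type*} [NormedAddCommGroup V] {f : ℝ → V}
    (hf : AEStronglyMeasurable f (vol (-1) 1)) :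
    AEStronglyMeasurable (fun x => f (-x)) (vol (-1) 1) :=
  hf.comp_measurePreserving measurePreserving_neg_vol

/-- Conjugate transposition and the reflection of (-1,1) both preserve the L₂ norm, so the defect of
H is at most twice its distance to `S N`. -/
theorem conjTranspose_ae_eq_of_tendsto {r : ℕ} (H : Lp (Mat r) 2 (vol (-1) 1))
    (S : ℕ → ℝ → Mat r) (hScont : ∀ N, Continuous (S N)) (hS : ∀ N x, (S N x)ᴴ = S N (-x))
    (hlim : Tendsto (fun N => eLpNorm (fun x => S N x - H x) 2 (vol (-1) 1)) atTop (𝓝 0)) :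
    ∀ᵐ x ∂(vol (-1) 1), (H x)ᴴ = H (-x) := by
  have hHm : AEStronglyMeasurable H (vol (-1) 1) := Lp.aestronglyMeasurable H
  have hHneg : AEStronglyMeasurable (fun x => H (-x)) (vol (-1) 1) :=
    aestronglyMeasurable_comp_neg hHm
  have hstar : Continuous (fun A : Mat r => Aᴴ) := by fun_prop
  have hHstar : AEStronglyMeasurable (fun x => (H x)ᴴ) (vol (-1) 1) :=
    hstar.comp_aestronglyMeasurable hHm
  have hdm (N : ℕ) : AEStronglyMeasurable (fun x => S N x - H x) (vol (-1) 1) :=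
    (hScont N).aestronglyMeasurable.sub hHm
  have hle (N : ℕ) : eLpNorm (fun x => (H x)ᴴ - H (-x)) 2 (vol (-1) 1) ≤
      eLpNorm (fun x => S N x - H x) 2 (vol (-1) 1) +
        eLpNorm (fun x => S N x - H x) 2 (vol (-1) 1) := by
    have h1 : (fun x => (H x)ᴴ - H (-x)) =
        (fun x => -(S N x - H x)ᴴ) + fun x => S N (-x) - H (-x) := by
      ext1 x
      simp only [Pi.add_apply, Matrix.conjTranspose_sub, hS]
      abel
    have h2 : eLpNorm (fun x => -(S N x - H x)ᴴ) 2 (vol (-1) 1) =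
        eLpNorm (fun x => S N x - H x) 2 (vol (-1) 1) := by
      refine eLpNorm_congr_norm_ae (ae_of_all _ fun x => ?_)
      rw [norm_neg, Matrix.l2_opNorm_conjTranspose]
    have h3 : eLpNorm (fun x => S N (-x) - H (-x)) 2 (vol (-1) 1) =
        eLpNorm (fun x => S N x - H x) 2 (vol (-1) 1) :=
      eLpNorm_comp_neg (f := fun x => S N x - H x) (hdm N)
    rw [h1]
    refine (eLpNorm_add_le ?_ ?_ (by norm_num)).trans (by rw [h2, h3])
    · exact (hstar.comp_aestronglyMeasurable (hdm N)).neg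
    · exact aestronglyMeasurable_comp_neg (f := fun x => S N x - H x) (hdm N)
  have h0 : eLpNorm (fun x => (H x)ᴴ - H (-x)) 2 (vol (-1) 1) = 0 := by
    refine le_antisymm (ge_of_tendsto' (by simpa using hlim.add hlim) hle) zero_le
  filter_upwards [(eLpNorm_eq_zero_iff (f := fun x => (H x)ᴴ - H (-x)) (hHstar.sub hHneg)
    (by norm_num)).1 h0] with x hx
  exact sub_eq_zero.1 hx

/-! ### The convolution operator -/

/-- The action of a matrix on a vector as a continuous bilinear map. -/
def matAct (r : ℕ) : Mat r →L[ℂ] Vec r →L[ℂ] Vec r :=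
  LinearMap.toContinuousLinearMap
    (Matrix.toEuclideanCLM (n := Fin r) (𝕜 := ℂ)).toAlgEquiv.toLinearMap

theorem matAct_apply {r : ℕ} (A : Mat r) (v : Vec r) :
    matAct r A v = Matrix.toEuclideanCLM (𝕜 := ℂ) A v := rfl

theorem norm_matAct_apply_le {r : ℕ} (A : Mat r) (v : Vec r) : ‖matAct r A v‖ ≤ ‖A‖ * ‖v‖ :=
  (ContinuousLinearMap.le_opNorm _ _).trans_eq (by
    rw [← Matrix.l2_opNorm_toEuclideanCLM A]; rfl)

/-- For x in (0,1), the map t ↦ x - t carries (0,1) onto (x - 1, x), which lies in (-1,1). -/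
theorem memLp_comp_sub {V : Type*} [NormedAddCommGroup V] {D : ℝ → V} (hD : MemLp D 2 (vol (-1) 1))
    {x : ℝ} (hx : x ∈ Set.Ioo (0 : ℝ) 1) :
    MemLp (fun t => D (x - t)) 2 (vol 0 1) ∧
      eLpNorm (fun t => D (x - t)) 2 (vol 0 1) ≤ eLpNorm D 2 (vol (-1) 1) := by
  have hle : vol (x - 1) x ≤ vol (-1) 1 :=
    Measure.restrict_mono (Set.Ioo_subset_Ioo (by linarith [hx.1]) hx.2.le) le_rfl
  have hmp : MeasurePreserving (fun t : ℝ => x - t) (vol 0 1) (vol (x - 1) x) := by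
    have h := (Measure.measurePreserving_sub_left (volume : Measure ℝ) x).restrict_preimage
      (measurableSet_Ioo (a := x - 1) (b := x))
    simpa [vol] using h
  have hD' := hD.mono_measure hle
  refine ⟨hD'.comp_measurePreserving hmp, ?_⟩
  have := eLpNorm_comp_measurePreserving (p := 2) hD'.1 hmp
  exact this.le.trans (eLpNorm_mono_measure _ hle)

theorem integrable_matAct_comp_sub {r : ℕ} {D : ℝ → Mat r} (hD : MemLp D 2 (vol (-1) 1))
    {g : ℝ → Vec r} (hg : MemLp g 2 (vol 0 1)) {x : ℝ} (hx : x ∈ Set.Ioo (0 : ℝ) 1) :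
    Integrable (fun t => matAct r (D (x - t)) (g t)) (vol 0 1) := by
  rw [← memLp_one_iff_integrable]
  have h1 := (memLp_comp_sub hD hx).1
  refine MemLp.of_bilin (p := 2) (q := 2) (fun A v => matAct r A v) 1 h1 hg
    ((matAct r).aestronglyMeasurable_comp₂ h1.1 hg.1) (ae_of_all _ fun t => ?_)
  rw [one_mul]
  exact norm_matAct_apply_le _ _

/-- Cauchy–Schwarz. The bound is uniform in x, so L₂ convergence of kernels gives uniform
convergence of the convolutions. -/
theorem enorm_integral_matAct_comp_sub_le {r : ℕ} {D : ℝ → Mat r} (hD : MemLp D 2 (vol (-1) 1))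
    {g : ℝ → Vec r} (hg : MemLp g 2 (vol 0 1)) {x : ℝ} (hx : x ∈ Set.Ioo (0 : ℝ) 1) :
    ‖∫ t, matAct r (D (x - t)) (g t) ∂vol 0 1‖ₑ ≤
      eLpNorm D 2 (vol (-1) 1) * eLpNorm g 2 (vol 0 1) := by
  refine (enorm_integral_le_lintegral_enorm _).trans ?_
  rw [← eLpNorm_one_eq_lintegral_enorm]
  have h1 := memLp_comp_sub hD hx
  refine (eLpNorm_le_eLpNorm_mul_eLpNorm'_of_norm (p := 2) (q := 2) h1.1.1 hg.1
    (fun A v => matAct r A v) 1 (ae_of_all _ fun t => ?_)).trans ?_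
  · rw [NNReal.coe_one, one_mul]
    exact norm_matAct_apply_le _ _
  · rw [ENNReal.coe_one, one_mul]
    gcongr
    exact h1.2

/-! ### Fourier coefficients and Bessel's inequality on the unit interval -/

/-- The Fourier transform `∫_0^1 e^{-2 i l t} g(t) dt`. -/
def fourierCoeffAt {V : Type*} [NormedAddCommGroup V] [NormedSpace ℂ V] (g : ℝ → V) (l : ℝ) : V :=
  ∫ t, expFun (-l) t • g t ∂vol 0 1

theorem integrable_expFun_smul {V : Type*} [NormedAddCommGroup V] [NormedSpace ℂ V] {g : ℝ → V}
    {μ : Measure ℝ} (hg : Integrable g μ) (l : ℝ) :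
    Integrable (fun t => expFun l t • g t) μ :=
  hg.bdd_smul 1 (continuous_expFun l).aestronglyMeasurable
    (ae_of_all _ fun t => (norm_expFun l t).le)

theorem inner_expFun_smul {V : Type*} [NormedAddCommGroup V] [InnerProductSpace ℂ V]
    (l t : ℝ) (v w : V) : inner ℂ (expFun l t • v) w = inner ℂ v (expFun (-l) t • w) := by
  rw [inner_smul_left, inner_smul_right, conj_expFun]

theorem integral_inner_expFun_smul_left {V : Type*} [NormedAddCommGroup V] [InnerProductSpace ℂ V]
    [CompleteSpace V] {g : ℝ → V} (hg : Integrable g (vol 0 1)) (l : ℝ) (v : V) :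
    ∫ x, inner ℂ (expFun l x • v) (g x) ∂vol 0 1 = inner ℂ v (fourierCoeffAt g l) := by
  simp only [inner_expFun_smul]
  exact integral_inner (integrable_expFun_smul hg _) v

theorem integral_inner_expFun_smul_right {V : Type*} [NormedAddCommGroup V]
    [InnerProductSpace ℂ V] [CompleteSpace V] {g : ℝ → V} (hg : Integrable g (vol 0 1)) (l : ℝ)
    (v : V) :
    ∫ x, inner ℂ (g x) (expFun l x • v) ∂vol 0 1 = inner ℂ (fourierCoeffAt g l) v := by
  rw [← inner_conj_symm, ← integral_inner_expFun_smul_left hg, ← integral_conj]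
  simp only [inner_conj_symm]

theorem sum_norm_fourierCoeffAt_sq_le {V : Type*} [NormedAddCommGroup V] [InnerProductSpace ℂ V]
    [CompleteSpace V] {g : ℝ → V} (hg : MemLp g 2 (vol 0 1)) (F : Finset ℤ) :
    ∑ n ∈ F, ‖fourierCoeffAt g (Real.pi * n)‖ ^ 2 ≤ ∫ x, ‖g x‖ ^ 2 ∂vol 0 1 := by
  have hgi : Integrable g (vol 0 1) := hg.integrable (by norm_num)
  -- The vectors `u n` are the projections of g onto the n-th modes. Then ‖S‖² = ⟨S, g⟩ = E, and
  -- Bessel is ‖S - g‖² ≥ 0.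
  let v (n : ℤ) : V := fourierCoeffAt g (Real.pi * n)
  have hm (n : ℤ) := memLp_expFun_smul 0 1 (Real.pi * n) (v n)
  let u (n : ℤ) : Lp V 2 (vol 0 1) := (hm n).toLp
  have huu (n m : ℤ) : inner ℂ (u n) (u m) = if n = m then ((‖v n‖ ^ 2 : ℝ) : ℂ) else 0 := by
    have h1 : inner ℂ (u n) (u m) = (∫ x, expFun (Real.pi * m) x *
        (starRingEnd ℂ) (expFun (Real.pi * n) x) ∂vol 0 (0 + (1 : ℕ))) * inner ℂ (v n) (v m) := by
      rw [L2.inner_def, ← integral_mul_const]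
      simp only [Nat.cast_one, zero_add]
      refine integral_congr_ae ?_
      filter_upwards [(hm n).coeFn_toLp, (hm m).coeFn_toLp] with x h1 h2
      simp only [u]
      rw [h1, h2, inner_smul_left, inner_smul_right]
      ring
    rw [h1, integral_expFun_mul]
    split_ifs with h
    · subst h
      rw [Nat.cast_one, one_mul, inner_self_eq_norm_sq_to_K]
      simp
    · simp
  have hug (n : ℤ) : inner ℂ (u n) hg.toLp = ((‖v n‖ ^ 2 : ℝ) : ℂ) := by
    have h1 : inner ℂ (u n) hg.toLp = inner ℂ (v n) (v n) := by
      rw [← integral_inner_expFun_smul_left hgi, L2.inner_def]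
      refine integral_congr_ae ?_
      filter_upwards [(hm n).coeFn_toLp, hg.coeFn_toLp] with x h1 h2
      simp only [u]
      rw [h1, h2]
    rw [h1, inner_self_eq_norm_sq_to_K]
    simp
  set E := ∑ n ∈ F, ‖v n‖ ^ 2 with hE
  set S := ∑ n ∈ F, u n with hS
  have hSS : ‖S‖ ^ 2 = E := by
    have : inner ℂ S S = (E : ℂ) := by
      rw [hS, hE, sum_inner, Complex.ofReal_sum]
      refine Finset.sum_congr rfl fun n hn => ?_
      simp [inner_sum, huu, hn]
    rw [← inner_self_eq_norm_sq (𝕜 := ℂ), this]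
    simp
  have hSg : RCLike.re (inner ℂ S hg.toLp) = E := by
    rw [hS, hE, sum_inner]
    simp only [hug]
    simp [-Complex.ofReal_pow]
  have hgg : ‖hg.toLp‖ ^ 2 = ∫ x, ‖g x‖ ^ 2 ∂vol 0 1 := by
    have h1 : inner ℂ hg.toLp hg.toLp = ((∫ x, ‖g x‖ ^ 2 ∂vol 0 1 : ℝ) : ℂ) := by
      rw [L2.inner_def, ← integral_complex_ofReal]
      refine integral_congr_ae ?_
      filter_upwards [hg.coeFn_toLp] with x h1
      rw [h1, inner_self_eq_norm_sq_to_K]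
      simp
    rw [← inner_self_eq_norm_sq (𝕜 := ℂ), h1]
    simp
  have h := norm_sub_sq (𝕜 := ℂ) S hg.toLp
  rw [hSS, hSg, hgg] at h
  linarith [sq_nonneg ‖S - hg.toLp‖]

/-! ### The quadratic form of the convolution operator -/

theorem inner_matAct {r : ℕ} (A : Mat r) (v : Vec r) :
    inner ℂ v (matAct r A v) = star v.ofLp ⬝ᵥ (A *ᵥ v.ofLp) := by
  rw [matAct_apply, EuclideanSpace.inner_eq_star_dotProduct, Matrix.ofLp_toEuclideanCLM,
    dotProduct_comm]

theorem re_inner_matAct_nonneg {r : ℕ} {A : Mat r} (hA : A.PosSemidef) (v : Vec r) :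
    0 ≤ (inner ℂ v (matAct r A v)).re := by
  rw [inner_matAct]
  exact (Complex.le_def.1 (hA.dotProduct_mulVec_nonneg _)).1

theorem matAct_eq_zero_of_re_inner {r : ℕ} {A : Mat r} (hA : A.PosSemidef) {v : Vec r}
    (h : (inner ℂ v (matAct r A v)).re ≤ 0) : matAct r A v = 0 := by
  have h1 : inner ℂ v (matAct r A v) = 0 := by
    have h2 := Complex.le_def.1 (hA.dotProduct_mulVec_nonneg v.ofLp)
    rw [← inner_matAct] at h2
    exact Complex.ext (le_antisymm h h2.1) h2.2.symm
  rw [inner_matAct, hA.dotProduct_mulVec_zero_iff] at h1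
  ext i
  rw [matAct_apply, Matrix.ofLp_toEuclideanCLM, h1]
  rfl

theorem inner_matAct_right {r : ℕ} {A : Mat r} (hA : A.IsHermitian) (v w : Vec r) :
    inner ℂ (matAct r A v) w = inner ℂ v (matAct r A w) := by
  have h : Matrix.toEuclideanCLM (𝕜 := ℂ) A = star (Matrix.toEuclideanCLM (𝕜 := ℂ) A) := by
    rw [← map_star, Matrix.star_eq_conjTranspose, hA.eq]
  rw [matAct_apply, matAct_apply]
  conv_rhs => rw [h]
  rw [ContinuousLinearMap.star_eq_adjoint, ContinuousLinearMap.adjoint_inner_right]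

/-- The exponential separates x from t; this is why Fourier coefficients of g appear in the
convolution. -/
theorem matAct_expFun_sub {r : ℕ} (l x t : ℝ) (A : Mat r) (v : Vec r) :
    matAct r (expFun l (x - t) • A) v = expFun l x • matAct r A (expFun (-l) t • v) := by
  have h : expFun l (x - t) = expFun l x * expFun (-l) t := by
    rw [expFun, expFun, expFun, ← Complex.exp_add]
    push_cast
    ring_nf
  rw [h, map_smul, smul_apply, map_smul, smul_smul]

theorem hasIntegral_matAct_expFun_sub {r : ℕ} {g : ℝ → Vec r} (hg : Integrable g (vol 0 1))
    (l x : ℝ) (A : Mat r) :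
    Integrable (fun t => matAct r (expFun l (x - t) • A) (g t)) (vol 0 1) ∧
      ∫ t, matAct r (expFun l (x - t) • A) (g t) ∂vol 0 1 =
        expFun l x • matAct r A (fourierCoeffAt g l) := by
  have hi := integrable_expFun_smul hg (-l)
  simp only [matAct_expFun_sub]
  refine ⟨((matAct r A).integrable_comp hi).smul (expFun l x), ?_⟩
  rw [integral_smul, (matAct r A).integral_comp_comm hi, fourierCoeffAt]

theorem integral_matAct_sum_block {r : ℕ} (a : Data r) (J : ℤ → Finset ℤ) (F : Finset ℤ)
    {g : ℝ → Vec r} (hg : Integrable g (vol 0 1)) (x : ℝ) :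
    ∫ t, matAct r (∑ n ∈ F, block a J n (x - t)) (g t) ∂vol 0 1 =
      ∑ n ∈ F, (∑ j ∈ J n, expFun (a.lam j) x • matAct r (a.alpha j) (fourierCoeffAt g (a.lam j)) -
        expFun (Real.pi * n) x • fourierCoeffAt g (Real.pi * n)) := by
  have h1 (t : ℝ) : matAct r (∑ n ∈ F, block a J n (x - t)) (g t) =
      ∑ n ∈ F, (∑ j ∈ J n, matAct r (expFun (a.lam j) (x - t) • a.alpha j) (g t) -
        matAct r (expFun (Real.pi * n) (x - t) • (1 : Mat r)) (g t)) := by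
    simp only [block, expFun, map_sum, map_sub, sum_apply,
      sub_apply]
  have h2 (n : ℤ) : Integrable (fun t => ∑ j ∈ J n,
      matAct r (expFun (a.lam j) (x - t) • a.alpha j) (g t)) (vol 0 1) :=
    integrable_finsetSum _ fun j _ => (hasIntegral_matAct_expFun_sub hg _ _ _).1
  have h3 (n : ℤ) := hasIntegral_matAct_expFun_sub hg (Real.pi * n) x (1 : Mat r)
  simp only [h1]
  refine (integral_finsetSum _ fun n _ => (h2 n).sub (h3 n).1).trans ?_
  refine Finset.sum_congr rfl fun n _ => ?_
  refine (integral_sub (h2 n) (h3 n).1).trans ?_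
  rw [(h3 n).2,
    integral_finsetSum _ fun j _ => (hasIntegral_matAct_expFun_sub hg _ _ _).1]
  congr 1
  · exact Finset.sum_congr rfl fun j _ => (hasIntegral_matAct_expFun_sub hg _ _ _).2
  · rw [matAct_apply, map_one, one_apply_eq_self]

theorem integrable_inner_expFun_smul {V : Type*} [NormedAddCommGroup V] [InnerProductSpace ℂ V]
    {g : ℝ → V} (hg : Integrable g (vol 0 1)) (l : ℝ) (v : V) :
    Integrable (fun x => inner ℂ (g x) (expFun l x • v)) (vol 0 1) := by
  have h := (integrable_expFun_smul hg (-l)).inner_const (𝕜 := ℂ) v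
  simpa only [inner_expFun_smul, neg_neg] using h

theorem integral_inner_integral_matAct_sum_block {r : ℕ} (a : Data r) (J : ℤ → Finset ℤ)
    (F : Finset ℤ) {g : ℝ → Vec r} (hg : Integrable g (vol 0 1)) :
    Integrable (fun x => inner ℂ (g x)
      (∫ t, matAct r (∑ n ∈ F, block a J n (x - t)) (g t) ∂vol 0 1)) (vol 0 1) ∧
    ∫ x, inner ℂ (g x) (∫ t, matAct r (∑ n ∈ F, block a J n (x - t)) (g t) ∂vol 0 1) ∂vol 0 1 =
      ∑ n ∈ F, (∑ j ∈ J n, inner ℂ (fourierCoeffAt g (a.lam j))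
          (matAct r (a.alpha j) (fourierCoeffAt g (a.lam j))) -
        ((‖fourierCoeffAt g (Real.pi * n)‖ ^ 2 : ℝ) : ℂ)) := by
  simp only [integral_matAct_sum_block a J F hg, inner_sum, inner_sub_right]
  have h2 (n : ℤ) : Integrable (fun x => ∑ j ∈ J n, inner ℂ (g x)
      (expFun (a.lam j) x • matAct r (a.alpha j) (fourierCoeffAt g (a.lam j)))) (vol 0 1) :=
    integrable_finsetSum _ fun j _ => integrable_inner_expFun_smul hg _ _
  have h3 (n : ℤ) := integrable_inner_expFun_smul hg (Real.pi * n)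
    (fourierCoeffAt g (Real.pi * n))
  refine ⟨integrable_finsetSum _ fun n _ => (h2 n).sub (h3 n), ?_⟩
  refine (integral_finsetSum _ fun n _ => (h2 n).sub (h3 n)).trans ?_
  refine Finset.sum_congr rfl fun n _ => ?_
  refine (integral_sub (h2 n) (h3 n)).trans ?_
  rw [integral_inner_expFun_smul_right hg,
    integral_finsetSum _ fun j _ => integrable_inner_expFun_smul hg _ _]
  congr 1
  · exact Finset.sum_congr rfl fun j _ => integral_inner_expFun_smul_right hg _ _
  · rw [inner_self_eq_norm_sq_to_K]
    simp

/-- If the quadratic form of `I + T_H` vanishes at `g`, where `T_H` is the convolution with `H`,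
then so do all its nonnegative summands. -/
theorem matAct_fourierCoeffAt_eq_zero {r : ℕ} (a : Data r) (J : ℤ → Finset ℤ)
    {H : Lp (Mat r) 2 (vol (-1) 1)} {F : ℕ → Finset ℤ} (hF : Tendsto F atTop atTop)
    (hH : Tendsto (fun N : ℕ => eLpNorm (fun x => ∑ n ∈ F N, block a J n x - H x) 2 (vol (-1) 1))
      atTop (𝓝 0))
    {g : ℝ → Vec r} (hg : MemLp g 2 (vol 0 1))
    (hgH : ∀ᵐ x ∂vol 0 1, inner ℂ (g x) (∫ t, matAct r (H (x - t)) (g t) ∂vol 0 1) =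
      -((‖g x‖ ^ 2 : ℝ) : ℂ))
    {n j : ℤ} (hj : j ∈ J n) :
    matAct r (a.alpha j) (fourierCoeffAt g (a.lam j)) = 0 := by
  have hgi : Integrable g (vol 0 1) := hg.integrable (by norm_num)
  have hg2 : Integrable (fun x => ‖g x‖ ^ 2) (vol 0 1) :=
    (memLp_two_iff_integrable_sq_norm hg.1).1 hg
  let S (N : ℕ) (x : ℝ) : Mat r := ∑ n ∈ F N, block a J n x
  have hS (N : ℕ) : MemLp (S N) 2 (vol (-1) 1) := memLp_finsetSum _ fun n _ => memLp_block a J n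
  have hD (N : ℕ) : MemLp (fun x => S N x - H x) 2 (vol (-1) 1) := (hS N).sub (Lp.memLp H)
  let ε (N : ℕ) : ℝ := (eLpNorm (fun x => S N x - H x) 2 (vol (-1) 1) *
    eLpNorm g 2 (vol 0 1)).toReal
  have hε : Tendsto ε atTop (𝓝 0) := by
    have h := ENNReal.Tendsto.mul_const (b := eLpNorm g 2 (vol 0 1)) hH (Or.inr hg.2.ne)
    rw [zero_mul] at h
    exact (ENNReal.tendsto_toReal ENNReal.zero_ne_top).comp h
  have hclose (N : ℕ) {x : ℝ} (hx : x ∈ Set.Ioo (0 : ℝ) 1) :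
      ‖∫ t, matAct r (S N (x - t)) (g t) ∂vol 0 1 -
        ∫ t, matAct r (H (x - t)) (g t) ∂vol 0 1‖ ≤ ε N := by
    rw [← integral_sub (integrable_matAct_comp_sub (hS N) hg hx)
      (integrable_matAct_comp_sub (Lp.memLp H) hg hx)]
    have h := enorm_integral_matAct_comp_sub_le (hD N) hg hx
    simp only [map_sub, sub_apply] at h
    rw [← toReal_enorm]
    exact ENNReal.toReal_mono (ENNReal.mul_ne_top (hD N).2.ne hg.2.ne) h
  have hform (N : ℕ) : ∑ n ∈ F N, ∑ j ∈ J n, (inner ℂ (fourierCoeffAt g (a.lam j))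
      (matAct r (a.alpha j) (fourierCoeffAt g (a.lam j)))).re ≤
      (∫ x, ‖g x‖ ∂vol 0 1) * ε N := by
    obtain ⟨hi, he⟩ := integral_inner_integral_matAct_sum_block a J (F N) hgi
    -- By `hgH` the integrand equals ⟨g, T_{S N} g - T_H g⟩, which `hclose` bounds.
    have h1 : ‖∫ x, (inner ℂ (g x) (∫ t, matAct r (S N (x - t)) (g t) ∂vol 0 1) +
        ((‖g x‖ ^ 2 : ℝ) : ℂ)) ∂vol 0 1‖ ≤ (∫ x, ‖g x‖ ∂vol 0 1) * ε N := by
      rw [← integral_mul_const]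
      refine norm_integral_le_of_norm_le (hgi.norm.mul_const _) ?_
      filter_upwards [hgH, ae_restrict_mem measurableSet_Ioo] with x h1 hx
      rw [← neg_eq_iff_eq_neg.2 h1, ← sub_eq_add_neg, ← inner_sub_right]
      exact (norm_inner_le_norm _ _).trans (by gcongr; exact hclose N hx)
    simp only [S] at h1
    have hg2c : Integrable (fun x => ((‖g x‖ ^ 2 : ℝ) : ℂ)) (vol 0 1) := hg2.ofReal
    rw [integral_add hi hg2c, he, integral_complex_ofReal] at h1
    have h2 := (Complex.re_le_norm _).trans h1
    rw [Complex.add_re, Complex.ofReal_re, Complex.re_sum] at h2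
    simp only [Complex.sub_re, Complex.re_sum, Complex.ofReal_re, Finset.sum_sub_distrib] at h2
    linarith [sum_norm_fourierCoeffAt_sq_le hg (F N)]
  refine matAct_eq_zero_of_re_inner (a.posSemidef j) ?_
  have hlim : Tendsto (fun N => (∫ x, ‖g x‖ ∂vol 0 1) * ε N) atTop (𝓝 0) := by
    simpa using hε.const_mul (∫ x, ‖g x‖ ∂vol 0 1)
  refine ge_of_tendsto hlim ?_
  -- Once `F N` contains n, the chosen term is at most the whole nonnegative sum.
  filter_upwards [hF.eventually (eventually_ge_atTop {n})] with N hN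
  have hnonneg (j : ℤ) := re_inner_matAct_nonneg (a.posSemidef j) (fourierCoeffAt g (a.lam j))
  refine le_trans ?_ (hform N)
  refine le_trans ?_ (Finset.single_le_sum (fun n _ => Finset.sum_nonneg fun j _ => hnonneg j)
    (Finset.singleton_subset_iff.1 hN))
  exact Finset.single_le_sum (fun j _ => hnonneg j) hj

/-! ### Completeness and the accelerant property -/

/-- Reconciles e^{2iλt} on (0,1), used for ĝ, with e^{iλs} on (-1,1), used in (A₃). -/
theorem map_add_one_div_two_vol :
    Measure.map (fun s : ℝ => (s + 1) * 2⁻¹) (vol (-1) 1) = (2 : ℝ≥0∞) • vol 0 1 := by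
  have h1 : Measure.map (fun s : ℝ => (s + 1) * 2⁻¹) volume = (2 : ℝ≥0∞) • volume := by
    have : (fun s : ℝ => (s + 1) * 2⁻¹) = (fun s => s * 2⁻¹) ∘ fun s => s + 1 := rfl
    rw [this, ← Measure.map_map (by fun_prop) (by fun_prop), map_add_right_eq_self,
      Real.map_volume_mul_right (by norm_num)]
    norm_num
  have h2 := Measure.restrict_map (μ := volume) (f := fun s : ℝ => (s + 1) * 2⁻¹) (by fun_prop)
    (measurableSet_Ioo (a := (0 : ℝ)) (b := 1))
  have h3 : (fun s : ℝ => (s + 1) * 2⁻¹) ⁻¹' Set.Ioo 0 1 = Set.Ioo (-1) 1 := by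
    ext s
    simp only [Set.mem_preimage, Set.mem_Ioo]
    constructor <;> rintro ⟨h1, h2⟩ <;> constructor <;> linarith
  rw [h1, h3, Measure.restrict_smul] at h2
  exact h2.symm

theorem ae_eq_zero_of_A3 {r : ℕ} (a : Data r) (hA3 : A3 a) {g : ℝ → Vec r}
    (hg : MemLp g 2 (vol 0 1))
    (h0 : ∀ j, matAct r (a.alpha j) (fourierCoeffAt g (a.lam j)) = 0) :
    g =ᵐ[vol 0 1] 0 := by
  have hgi : Integrable g (vol 0 1) := hg.integrable (by norm_num)
  let φ : ℝ → ℝ := fun s => (s + 1) * 2⁻¹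
  have hφ : Measurable φ := by fun_prop
  have hg' : MemLp g 2 (Measure.map φ (vol (-1) 1)) := by
    rw [map_add_one_div_two_vol]; exact hg.smul_measure (by norm_num)
  have hh : MemLp (g ∘ φ) 2 (vol (-1) 1) := hg'.comp_of_map hφ.aemeasurable
  have hinner : ∀ u ∈ expSystem a, inner ℂ u hh.toLp = 0 := by
    rintro u ⟨j, d, ⟨v, rfl⟩, hu⟩
    -- With t = (s + 1)/2, e^{iλs} = e^{2iλt} e^{-iλ}; the constant factor e^{-iλ} does not affect
    -- orthogonality.
    have h1 : inner ℂ u hh.toLp = ∫ s, inner ℂ (expFun (a.lam j) (φ s) •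
        (Complex.exp (-Complex.I * a.lam j) • matAct r (a.alpha j) v)) (g (φ s)) ∂vol (-1) 1 := by
      rw [L2.inner_def]
      refine integral_congr_ae ?_
      filter_upwards [hu, hh.coeFn_toLp] with s h1 h2
      rw [h1, h2, smul_smul, expFun, ← Complex.exp_add, matAct_apply, Function.comp_apply]
      congr 3
      simp only [φ]
      push_cast
      ring
    have hm : AEStronglyMeasurable (fun x => inner ℂ (expFun (a.lam j) x •
        (Complex.exp (-Complex.I * a.lam j) • matAct r (a.alpha j) v)) (g x))
        (Measure.map φ (vol (-1) 1)) :=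
      ((continuous_expFun _).smul continuous_const).aestronglyMeasurable.inner hg'.1
    rw [h1, ← integral_map hφ.aemeasurable hm, map_add_one_div_two_vol, integral_smul_measure,
      integral_inner_expFun_smul_left hgi, inner_smul_left,
      inner_matAct_right (a.posSemidef j).isHermitian, h0, inner_zero_right, mul_zero, smul_zero]
  have hzero : hh.toLp = 0 := by
    refine Dense.eq_zero_of_inner_right ℂ hA3 fun u hu => ?_
    induction hu using Submodule.span_induction with
    | mem u hu => exact hinner u hu
    | zero => exact inner_zero_left _
    | add u w _ _ hu hw => rw [inner_add_left, hu, hw, add_zero]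
    | smul c u _ hu => rw [inner_smul_left, hu, mul_zero]
  have h2 : eLpNorm g 2 (Measure.map φ (vol (-1) 1)) = 0 := by
    rw [eLpNorm_map_measure hg'.1 hφ.aemeasurable, ← eLpNorm_congr_ae hh.coeFn_toLp, hzero,
      eLpNorm_congr_ae (Lp.coeFn_zero _ _ _), eLpNorm_zero]
  rw [eLpNorm_eq_zero_iff hg'.1 (by norm_num), map_add_one_div_two_vol] at h2
  exact (Measure.ae_ennreal_smul_measure_iff (by norm_num)).1 h2

theorem isAccelerant_of_tendsto {r : ℕ} (a : Data r) (hA3 : A3 a) (J : ℤ → Finset ℤ)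
    (hJ : ∀ n j, j ∈ J n ↔ a.lam j ∈ Delta n)
    {H : Lp (Mat r) 2 (vol (-1) 1)} {F : ℕ → Finset ℤ} (hF : Tendsto F atTop atTop)
    (hH : Tendsto (fun N : ℕ => eLpNorm (fun x => ∑ n ∈ F N, block a J n x - H x) 2 (vol (-1) 1))
      atTop (𝓝 0)) : IsAccelerant H := by
  intro c hc f hf
  let g : ℝ → Vec r := (Set.Ioo 0 c).indicator f
  have hg : MemLp g 2 (vol 0 1) := (Lp.memLp f).indicator measurableSet_Ioo
  have hconv (x : ℝ) : ∫ t in (0 : ℝ)..c, Matrix.toEuclideanCLM (𝕜 := ℂ) (H (x - t)) (f t) =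
      ∫ t, matAct r (H (x - t)) (g t) ∂vol 0 1 := by
    have h1 (t : ℝ) : matAct r (H (x - t)) (g t) =
        (Set.Ioo 0 c).indicator (fun t => matAct r (H (x - t)) (f t)) t := by
      by_cases ht : t ∈ Set.Ioo 0 c <;> simp [g, ht]
    simp only [h1]
    rw [setIntegral_indicator measurableSet_Ioo, Set.inter_eq_right.2
      (Set.Ioo_subset_Ioo_right hc.2), intervalIntegral.integral_of_le hc.1,
      integral_Ioc_eq_integral_Ioo]
    rfl
  simp only [hconv] at hf
  have hgH : ∀ᵐ x ∂vol 0 1, inner ℂ (g x) (∫ t, matAct r (H (x - t)) (g t) ∂vol 0 1) =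
      -((‖g x‖ ^ 2 : ℝ) : ℂ) := by
    filter_upwards [hf] with x hx
    rw [← neg_eq_of_add_eq_zero_right hx]
    -- Outside (0, c) both sides vanish because g(x) = 0.
    by_cases hxc : x ∈ Set.Ioo 0 c
    · simp only [g, Set.indicator_of_mem hxc]
      rw [inner_neg_right, inner_self_eq_norm_sq_to_K]
      simp
    · simp [g, hxc]
  have hg0 := ae_eq_zero_of_A3 a hA3 hg fun j =>
    matAct_fourierCoeffAt_eq_zero a J hF hH hg hgH ((hJ _ _).2 ((mem_Delta_iff _ _).2 rfl))
  -- g = 0 gives f = 0 only on (0, c); on the rest of (0,1) it follows from the equation, whose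
  -- integral term is now zero.
  refine Lp.ext ?_
  filter_upwards [hf, Lp.coeFn_zero (Vec r) 2 (vol 0 1)] with x hx h0
  have hzero : ∫ t, matAct r (H (x - t)) (g t) ∂vol 0 1 = 0 := by
    refine integral_eq_zero_of_ae ?_
    filter_upwards [hg0] with t ht
    simp [ht]
  rw [hzero, add_zero] at hx
  rw [hx, h0, Pi.zero_apply]

theorem A1.exists_index {r : ℕ} {a : Data r} (h : A1 a) :
    ∃ J : ℤ → Finset ℤ, (∀ n j, j ∈ J n ↔ a.lam j ∈ Delta n) ∧
      Summable fun n => blockBound a J n ^ 2 := by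
  obtain ⟨C, hC⟩ := h.bounded_card
  have hfin (n : ℤ) : {j : ℤ | a.lam j ∈ Delta n}.Finite :=
    Set.encard_lt_top_iff.1 ((hC n).trans_lt (ENat.natCast_lt_top C))
  refine ⟨fun n => (hfin n).toFinset, fun n j => by simp,
    summable_blockBound_sq a _ (C := C) (fun n => ?_) ?_ ?_⟩
  · have := hC n
    rw [(hfin n).encard_eq_coe_toFinset_card] at this
    exact_mod_cast this
  · simpa only [finsum_mem_eq_finite_toFinset_sum _ (hfin _)] using h.summable_lam
  · simpa only [finsum_mem_eq_finite_toFinset_sum _ (hfin _)] using h.summable_alpha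

theorem tendsto_finset_Icc_atTop {u v : ℕ → ℤ} (hu : Tendsto u atTop atBot)
    (hv : Tendsto v atTop atTop) : Tendsto (fun N => Finset.Icc (u N) (v N)) atTop atTop := by
  refine tendsto_atTop.2 fun s => ?_
  have h : ∀ n ∈ s, ∀ᶠ N in atTop, n ∈ Finset.Icc (u N) (v N) := fun n _ => by
    filter_upwards [hu.eventually (eventually_le_atBot n),
      hv.eventually (eventually_ge_atTop n)] with N h1 h2
    exact Finset.mem_Icc.2 ⟨h1, h2⟩
  filter_upwards [(Finset.eventually_all s).2 h] with N hN
  exact hN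

end KreinDirac

end

theorem theorem3 {r : ℕ} (a : KreinDirac.Data r) (hA1 : KreinDirac.A1 a) :
    ∃ H : Lp (KreinDirac.Mat r) 2 (KreinDirac.vol (-1) 1),
      Tendsto (fun n : ℕ => eLpNorm (fun x => KreinDirac.fourierIntegral a
          (-(Real.pi * ((n : ℝ) - 1 / 2))) (Real.pi * ((n : ℝ) + 1 / 2)) x - H x)
        2 (KreinDirac.vol (-1) 1)) atTop (𝓝 0) ∧
      Tendsto (fun n : ℕ => eLpNorm (fun x => KreinDirac.fourierIntegral a
          (-(Real.pi * ((n : ℝ) + 1 / 2))) (Real.pi * ((n : ℝ) + 1 / 2)) x - H x)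
        2 (KreinDirac.vol (-1) 1)) atTop (𝓝 0) ∧
      (KreinDirac.A3 a → H ∈ KreinDirac.symAccelerants r) := by
  obtain ⟨J, hJ, hsum⟩ := hA1.exists_index
  obtain ⟨H, hH⟩ := KreinDirac.summable_block a J hJ hsum
  have hneg : Tendsto (fun N : ℕ => -(N : ℤ)) atTop atBot :=
    tendsto_neg_atTop_atBot.comp tendsto_natCast_atTop_atTop
  have hF := KreinDirac.tendsto_finset_Icc_atTop hneg tendsto_natCast_atTop_atTop
  -- The lower end -π(n - 1/2) is the left end of the cell with index -n + 1; in the symmetric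
  -- window it is that of index -n.
  have hF' := KreinDirac.tendsto_finset_Icc_atTop (tendsto_atBot_add_const_right _ 1 hneg)
    tendsto_natCast_atTop_atTop
  have hlim := KreinDirac.tendsto_eLpNorm_sum_block_sub a J hH hF
  refine ⟨H, ?_, ?_, fun hA3 => ⟨KreinDirac.isAccelerant_of_tendsto a hA3 J hJ hF hlim, ?_⟩⟩
  · refine (KreinDirac.tendsto_eLpNorm_sum_block_sub a J hH hF').congr fun N => ?_
    simp only [← KreinDirac.fourierIntegral_eq_sum_block a J hJ]
    push_cast
    ring_nf
  · refine hlim.congr fun N => ?_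
    simp only [← KreinDirac.fourierIntegral_eq_sum_block a J hJ]
    push_cast
    ring_nf
  · refine KreinDirac.conjTranspose_ae_eq_of_tendsto H
      (fun N x => ∑ n ∈ Finset.Icc (-(N : ℤ)) N, KreinDirac.block a J n x)
      (fun N => continuous_finsetSum _ fun n _ => KreinDirac.continuous_block a J n)
      (fun N x => ?_) hlim
    simp only [Matrix.conjTranspose_sum, KreinDirac.block_conjTranspose]
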